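/- There are universal constants $c, C, \gamma_1, \gamma_2, \gamma_3, \gamma_4 > 0$ such that the following holds for all integers $n, k$ with $1 \le k \le n/16$, every fixed index $i^* \in \{1,\dots,n\}$, and every random $n \times k$ matrix $\tilde V$ with i.i.d. $N(0,1)$ entries and columns $\tilde v_1,\dots,\tilde v_k$. With failure probability at most $\gamma_1 e^{-\gamma_2 n} + \gamma_3 e^{-\gamma_4 k}$, all of the following hold simultaneously: (1) The minimum of $\|\tilde V \tilde x\|_1$ over all $\tilde x \in \mathbb{R}^k$ with $(\tilde V \tilde x)(i^*) = 1$ is attained and $$ c\,\frac{n}{\sqrt k} \;\le\; \min\{\|\tilde V \tilde x\|_1 : (\tilde V\tilde x)(i^*) = 1\} \;\le\; C\,\frac{n}{\sqrt k}. $$ (2) For every nonzero $v \in \mathbb{R}^n$ with $|v(i^*)| = \|v\|_\infty$: if $v/v(i^*)$ minimizes $\|z\|_1$ subject to $z \in \mathrm{span}\{v, \tilde v_1, \dots, \tilde v_k\}$ and $z(i^*) = 1$, then $\|v\|_1/\|v\|_\infty \le C n/\sqrt k$. (3) For every nonzero $v \in \mathbb{R}^n$: if $v$ minimizes $\|z\|_1/\|z\|_\infty$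 over all nonzero $z \in \mathrm{span}\{v, \tilde v_1, \dots, \tilde v_k\}$, then $\|v\|_1/\|v\|_\infty \le C n/\sqrt k$. -/

import Mathlib

open MeasureTheory ProbabilityTheory

namespace SparsestElement

/-- The `ℓ₁` norm of a vector. -/
def l1Norm {n : ℕ} (z : Fin n → ℝ) : ℝ := ∑ l, |z l|

/-- The ratio `‖z‖₁ / ‖z‖_∞` (the norm of the type `Fin n → ℝ` is the sup norm); it is only
used for `z ≠ 0`. -/
noncomputable def l1LinfRatio {n : ℕ} (z : Fin n → ℝ) : ℝ := l1Norm z / ‖z‖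

/-- A random `n × k` matrix with i.i.d. `N(0,1)` entries. -/
structure IsStdGaussianMatrix {Ω : Type*} [MeasurableSpace Ω] {n k : ℕ}
    (V : Ω → Matrix (Fin n) (Fin k) ℝ) (μ : Measure Ω) : Prop where
  hasLaw_entry : ∀ l j, HasLaw (fun ω => V ω l j) (gaussianReal 0 1) μ
  indep_entries : iIndepFun (fun (p : Fin n × Fin k) (ω : Ω) => V ω p.1 p.2) μ

/-- The subspace spanned by `v` and the columns of `A`. -/
def plantedSubspace {n k : ℕ} (v : Fin n → ℝ) (A : Matrix (Fin n) (Fin k) ℝ) :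
    Submodule ℝ (Fin n → ℝ) :=
  Submodule.span ℝ (insert v (Set.range fun (j : Fin k) (l : Fin n) => A l j))

/-- `z` solves the linear program: minimize `‖z‖₁` such that `z ∈ W` and `z(i) = 1`. -/
def SolvesProgram {n : ℕ} (W : Submodule ℝ (Fin n → ℝ)) (i : Fin n) (z : Fin n → ℝ) : Prop :=
  (z ∈ W ∧ z i = 1) ∧ ∀ y ∈ W, y i = 1 → l1Norm z ≤ l1Norm y

/-- `z` solves the problem: minimize `‖z‖₁ / ‖z‖_∞` such that `z ∈ W` and `z ≠ 0`. -/
def MinimizesRatio {n : ℕ} (W : Submodule ℝ (Fin n → ℝ)) (z : Fin n → ℝ) : Prop :=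
  (z ∈ W ∧ z ≠ 0) ∧ ∀ y ∈ W, y ≠ 0 → l1LinfRatio z ≤ l1LinfRatio y

/-- `m` is the (attained) minimum of `‖A x‖₁` subject to `(A x)(i) = 1`. -/
def IsProgramMin {n k : ℕ} (A : Matrix (Fin n) (Fin k) ℝ) (i : Fin n) (m : ℝ) : Prop :=
  IsLeast {t : ℝ | ∃ x : Fin k → ℝ, A.mulVec x i = 1 ∧ t = l1Norm (A.mulVec x)} m

end SparsestElement

/-! With high probability `x ↦ ‖V x‖₁` is comparable to `n ‖x‖₂` and the row `u` of index `i` has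
norm of order `√k`. The constraint reads `⟨u, x⟩ = 1`, so feasible `x` have `‖x‖₂ ≥ 1 / ‖u‖`, with
equality at `u / ‖u‖²`; hence the minimum is of order `n / √k` (`conclusions_of_bounds`). This
near-optimal point lies in every planted subspace, whatever `v` is, so it competes with all `v` at
once and no union over `v` is needed.

For a fixed unit `x`, the vector `V x` is standard Gaussian (`hasLaw_mulVec`), and Chernoff bounds
control its norms up to probability `exp (-3 n)`. A union bound over a net of at most `exp (16 k) ≤
exp n` points, followed by `norm_bounds_of_bounds_on_net`, gives all `x`. The same tail bounds in
dimension `k` handle the row. -/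

namespace SparsestElement

open scoped ENNReal

/-! ### Tail bounds for standard Gaussian vectors. -/

/-- Chernoff bound for i.i.d. coordinates. -/
lemma measure_sum_nonneg_le_pow {Ω ι : Type*} [MeasurableSpace Ω] [Fintype ι] {μ : Measure Ω}
    {ν : Measure ℝ} [IsProbabilityMeasure ν] {Y : Ω → ι → ℝ}
    (hY : HasLaw Y (Measure.pi fun _ => ν) μ) {f : ℝ → ℝ} (hf : Measurable f) :
    μ {ω | 0 ≤ ∑ l, f (Y ω l)} ≤ (∫⁻ y, ENNReal.ofReal (Real.exp (f y)) ∂ν) ^ Fintype.card ι := by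
  set F : ℝ → ℝ≥0∞ := fun y => ENNReal.ofReal (Real.exp (f y)) with hF
  have hFm : Measurable F := by fun_prop
  have hprod (y : ι → ℝ) : ENNReal.ofReal (Real.exp (∑ l, f (y l))) = ∏ l, F (y l) := by
    rw [Real.exp_sum, ENNReal.ofReal_prod_of_nonneg fun _ _ => (Real.exp_pos _).le]
  have hms : MeasurableSet {y : ι → ℝ | 0 ≤ ∑ l, f (y l)} :=
    measurableSet_le measurable_const (by fun_prop)
  rw [hY.measure_eq hms]
  calc (Measure.pi fun _ : ι => ν) {y | 0 ≤ ∑ l, f (y l)}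
      ≤ (Measure.pi fun _ : ι => ν) {y | 1 ≤ ∏ l, F (y l)} := by
        refine measure_mono fun y hy => ?_
        rw [Set.mem_ofPred_eq, ← hprod, ENNReal.one_le_ofReal, Real.one_le_exp_iff]
        exact hy
    _ ≤ ∫⁻ y, ∏ l, F (y l) ∂(Measure.pi fun _ : ι => ν) := by
        simpa using mul_meas_ge_le_lintegral (μ := Measure.pi fun _ : ι => ν)
          (f := fun y => ∏ l, F (y l)) (by fun_prop) 1
    _ = ∏ l : ι, ∫⁻ y, F (y l) ∂(Measure.pi fun _ : ι => ν) :=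
        lintegral_prod_eq_prod_lintegral_of_indepFun Finset.univ
          (fun (l : ι) (y : ι → ℝ) => F (y l))
          (iIndepFun_pi (X := fun _ => F) fun _ => hFm.aemeasurable) (by fun_prop)
    _ = (∫⁻ y, F y ∂ν) ^ Fintype.card ι := by
        have (l : ι) : ∫⁻ y, F (y l) ∂(Measure.pi fun _ : ι => ν) = ∫⁻ y, F y ∂ν :=
          (measurePreserving_eval (fun _ : ι => ν) l).lintegral_comp hFm
        simp [this]

lemma lintegral_exp_neg_abs_gaussianReal_le {a : ℝ} (ha : 0 < a) :
    ∫⁻ y, ENNReal.ofReal (Real.exp (-(a * |y|))) ∂(gaussianReal 0 1) ≤ ENNReal.ofReal (1 / a) := by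
  have hint : ∫ y : ℝ, Real.exp (-(a * |y|)) = 2 / a := by
    have h := integral_comp_abs (f := fun y => Real.exp (-a * y))
    rw [integral_exp_mul_Ioi (by linarith)] at h
    simp only [neg_mul, mul_zero, Real.exp_zero] at h
    rw [h]; field_simp
  -- A non-integrable function has integral `0` by convention, so the nonzero value forces
  -- integrability.
  have hi : Integrable fun y : ℝ => Real.exp (-(a * |y|)) := by
    by_contra h
    rw [integral_undef h] at hint
    have : 0 < 2 / a := by positivity
    linarith
  have hpdf (y : ℝ) : gaussianPDFReal 0 1 y ≤ 1 / 2 := by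
    have h2 : (2 : ℝ) ≤ √(2 * Real.pi * (1 : NNReal)) := by
      apply Real.le_sqrt_of_sq_le
      have := Real.pi_gt_three
      simp; linarith
    have h1 : Real.exp (-(y - 0) ^ 2 / (2 * (1 : NNReal))) ≤ 1 :=
      Real.exp_le_one_iff.2 (div_nonpos_of_nonpos_of_nonneg (by nlinarith [sq_nonneg (y - 0)])
        (by positivity))
    rw [gaussianPDFReal_def, one_div]
    exact (mul_le_of_le_one_right (by positivity) h1).trans (inv_anti₀ two_pos h2)
  rw [gaussianReal_of_var_ne_zero 0 one_ne_zero,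
    lintegral_withDensity_eq_lintegral_mul _ (measurable_gaussianPDF 0 1) (by fun_prop)]
  calc _ ≤ ∫⁻ y, ENNReal.ofReal (1 / 2 * Real.exp (-(a * |y|))) := by
        refine lintegral_mono fun y => ?_
        rw [Pi.mul_apply, gaussianPDF, ← ENNReal.ofReal_mul (gaussianPDFReal_nonneg _ _ _)]
        exact ENNReal.ofReal_le_ofReal (mul_le_mul_of_nonneg_right (hpdf y) (Real.exp_pos _).le)
    _ = ENNReal.ofReal (∫ y, 1 / 2 * Real.exp (-(a * |y|))) :=
        (ofReal_integral_eq_lintegral_ofReal (hi.const_mul _)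
          (Filter.Eventually.of_forall fun y => by positivity)).symm
    _ = ENNReal.ofReal (1 / a) := by
        rw [integral_const_mul, hint]; congr 1; ring

lemma lintegral_exp_sq_gaussianReal :
    ∫⁻ y, ENNReal.ofReal (Real.exp (y ^ 2 / 4)) ∂(gaussianReal 0 1) = ENNReal.ofReal √2 := by
  rw [gaussianReal_of_var_ne_zero 0 one_ne_zero,
    lintegral_withDensity_eq_lintegral_mul _ (measurable_gaussianPDF 0 1) (by fun_prop)]
  have (y : ℝ) : (gaussianPDF 0 1 * fun y => ENNReal.ofReal (Real.exp (y ^ 2 / 4))) y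
      = ENNReal.ofReal √2 * gaussianPDF 0 2 y := by
    rw [Pi.mul_apply, gaussianPDF, gaussianPDF, ← ENNReal.ofReal_mul (gaussianPDFReal_nonneg _ _ _),
      ← ENNReal.ofReal_mul (by positivity), gaussianPDFReal_def, gaussianPDFReal_def]
    congr 1
    simp only [NNReal.coe_one, NNReal.coe_ofNat, sub_zero, mul_one]
    rw [mul_assoc, ← Real.exp_add, show (2 * Real.pi * 2 : ℝ) = 2 * (2 * Real.pi) by ring,
      Real.sqrt_mul zero_le_two (2 * Real.pi), mul_inv, ← mul_assoc, ← mul_assoc,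
      mul_inv_cancel₀ (by positivity), one_mul]
    congr 2
    ring
  simp_rw [this]
  rw [lintegral_const_mul _ (measurable_gaussianPDF 0 2),
    lintegral_gaussianPDF_eq_one 0 two_ne_zero, mul_one]

/-- The Gaussian density is at most `1/2`, so `E exp (1 - 200 |y|) ≤ e / 200`, which is below `e⁻⁴`
because `e⁵ ≤ 200`. The rate must exceed the entropy of the net, hence the small threshold `1/200`.
-/
lemma measure_sum_abs_le {Ω ι : Type*} [MeasurableSpace Ω] [Fintype ι] {μ : Measure Ω}
    {Y : Ω → ι → ℝ} (hY : HasLaw Y (Measure.pi fun _ => gaussianReal 0 1) μ) :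
    μ {ω | ∑ l, |Y ω l| ≤ Fintype.card ι / 200} ≤
      ENNReal.ofReal (Real.exp (-4 * Fintype.card ι)) := by
  have h := measure_sum_nonneg_le_pow hY (f := fun y => 1 + -(200 * |y|)) (by fun_prop)
  have he : ∫⁻ y, ENNReal.ofReal (Real.exp (1 + -(200 * |y|))) ∂(gaussianReal 0 1) ≤
      ENNReal.ofReal (Real.exp (-4)) := by
    simp_rw [Real.exp_add, ENNReal.ofReal_mul (Real.exp_pos 1).le]
    rw [lintegral_const_mul _ (by fun_prop)]
    calc _ ≤ ENNReal.ofReal (Real.exp 1) * ENNReal.ofReal (1 / 200) := by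
          gcongr; exact lintegral_exp_neg_abs_gaussianReal_le (by norm_num)
      _ = ENNReal.ofReal (Real.exp 1 / 200) := by
          rw [← ENNReal.ofReal_mul (Real.exp_pos 1).le]; congr 1; ring
      _ ≤ _ := by
          apply ENNReal.ofReal_le_ofReal
          have h5 : Real.exp 1 ^ 5 ≤ 200 :=
            (pow_le_pow_left₀ (Real.exp_pos 1).le Real.exp_one_lt_d9.le 5).trans (by norm_num)
          rw [show (-4 : ℝ) = 1 - 5 by norm_num, Real.exp_sub,
            show Real.exp 5 = Real.exp 1 ^ 5 by rw [← Real.exp_nat_mul]; norm_num]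
          gcongr
  refine (measure_mono fun ω hω => ?_).trans (h.trans ((pow_le_pow_left' he _).trans_eq ?_))
  · simp only [Set.mem_ofPred_eq, Finset.sum_add_distrib, Finset.sum_neg_distrib,
      ← Finset.mul_sum] at hω ⊢
    simp only [Finset.sum_const, Finset.card_univ, nsmul_eq_mul, mul_one]
    linarith
  · rw [← ENNReal.ofReal_pow (Real.exp_pos _).le, ← Real.exp_nat_mul, mul_comm]

lemma measure_le_sum_sq {Ω ι : Type*} [MeasurableSpace Ω] [Fintype ι] {μ : Measure Ω}
    {Y : Ω → ι → ℝ} (hY : HasLaw Y (Measure.pi fun _ => gaussianReal 0 1) μ) :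
    μ {ω | 16 * (Fintype.card ι : ℝ) ≤ ∑ l, Y ω l ^ 2} ≤
      ENNReal.ofReal (Real.exp (-3 * Fintype.card ι)) := by
  have h := measure_sum_nonneg_le_pow hY (f := fun y => -4 + y ^ 2 / 4) (by fun_prop)
  have he : ∫⁻ y, ENNReal.ofReal (Real.exp (-4 + y ^ 2 / 4)) ∂(gaussianReal 0 1) ≤
      ENNReal.ofReal (Real.exp (-3)) := by
    simp_rw [Real.exp_add, ENNReal.ofReal_mul (Real.exp_pos (-4)).le]
    rw [lintegral_const_mul _ (by fun_prop), lintegral_exp_sq_gaussianReal,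
      ← ENNReal.ofReal_mul (Real.exp_pos _).le]
    apply ENNReal.ofReal_le_ofReal
    have h2 : √2 ≤ Real.exp 1 :=
      (Real.sqrt_le_sqrt (by norm_num : (2 : ℝ) ≤ 2 ^ 2)).trans
        (by rw [Real.sqrt_sq zero_le_two]; linarith [Real.add_one_le_exp 1])
    calc _ ≤ Real.exp (-4) * Real.exp 1 := by gcongr
      _ = _ := by rw [← Real.exp_add]; norm_num
  refine (measure_mono fun ω hω => ?_).trans (h.trans ((pow_le_pow_left' he _).trans_eq ?_))
  · simp only [Set.mem_ofPred_eq, Finset.sum_add_distrib, ← Finset.sum_div] at hω ⊢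
    simp only [Finset.sum_const, Finset.card_univ, nsmul_eq_mul]
    linarith
  · rw [← ENNReal.ofReal_pow (Real.exp_pos _).le, ← Real.exp_nat_mul, mul_comm]

/-! ### Laws of the rows and of `V x`. -/

namespace IsStdGaussianMatrix

variable {Ω : Type*} [MeasurableSpace Ω] {μ : Measure Ω} {n k : ℕ}
  {V : Ω → Matrix (Fin n) (Fin k) ℝ}

lemma hasLaw_row (hV : IsStdGaussianMatrix V μ) (i : Fin n) :
    HasLaw (fun ω => V ω i) (Measure.pi fun _ => gaussianReal 0 1) μ :=
  iIndepFun.hasLaw_pi (X := fun j ω => V ω i j) (fun j => hV.hasLaw_entry i j)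
    (hV.indep_entries.precomp (g := fun j => (i, j)) fun _ _ h => (Prod.ext_iff.1 h).2)

lemma covariance_entry (hV : IsStdGaussianMatrix V μ) (p q : Fin n × Fin k) :
    cov[fun ω => V ω p.1 p.2, fun ω => V ω q.1 q.2; μ] = if p = q then 1 else 0 := by
  have hG (p : Fin n × Fin k) : MemLp (fun ω => V ω p.1 p.2) 2 μ :=
    (hV.hasLaw_entry p.1 p.2).hasGaussianLaw.memLp_two
  split_ifs with h
  · subst h
    rw [covariance_self (hG p).aemeasurable, (hV.hasLaw_entry p.1 p.2).variance_eq,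
      variance_id_gaussianReal, NNReal.coe_one]
  · exact (hV.indep_entries.indepFun h).covariance_eq_zero (hG p) (hG q)

lemma covariance_mulVec (hV : IsStdGaussianMatrix V μ) (x : Fin k → ℝ) (l m : Fin n) :
    cov[fun ω => (V ω).mulVec x l, fun ω => (V ω).mulVec x m; μ] =
      if l = m then ∑ j, x j ^ 2 else 0 := by
  have hG (l : Fin n) (j : Fin k) : MemLp (fun ω => V ω l j * x j) 2 μ :=
    ((hV.hasLaw_entry l j).hasGaussianLaw.memLp_two).mul_const _
  have := hV.indep_entries.isProbabilityMeasure
  simp only [Matrix.mulVec, dotProduct]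
  rw [covariance_fun_sum_fun_sum (hG l) (hG m)]
  simp_rw [covariance_mul_const_left, covariance_mul_const_right]
  have h (j j' : Fin k) : cov[fun ω => V ω l j, fun ω => V ω m j'; μ] =
      if l = m ∧ j = j' then 1 else 0 := by
    simpa [Prod.ext_iff] using hV.covariance_entry (l, j) (m, j')
  simp_rw [h]
  split_ifs with hlm
  · simp [hlm, sq]
  · simp [hlm]

lemma hasLaw_mulVec (hV : IsStdGaussianMatrix V μ) {x : Fin k → ℝ} (hx : ∑ j, x j ^ 2 = 1) :
    HasLaw (fun ω => (V ω).mulVec x) (Measure.pi fun _ => gaussianReal 0 1) μ := by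
  have := hV.indep_entries.isProbabilityMeasure
  have hJ : HasGaussianLaw (fun ω (p : Fin n × Fin k) => V ω p.1 p.2) μ :=
    iIndepFun.hasGaussianLaw (fun p => (hV.hasLaw_entry p.1 p.2).hasGaussianLaw) hV.indep_entries
  -- Joint Gaussianity, as a linear image of all entries, is what lets vanishing covariances give
  -- independence.
  have hJx : HasGaussianLaw (fun ω l => (V ω).mulVec x l) μ := by
    let L : (Fin n × Fin k → ℝ) →L[ℝ] (Fin n → ℝ) :=
      ContinuousLinearMap.pi fun l => ∑ j, x j • ContinuousLinearMap.proj (l, j)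
    have hL : (fun ω l => (V ω).mulVec x l) = fun ω => L fun p => V ω p.1 p.2 := by
      ext ω l
      simp [L, Matrix.mulVec, dotProduct, mul_comm]
    rw [hL]
    exact hJ.map_fun L
  have hind : iIndepFun (fun l ω => (V ω).mulVec x l) μ :=
    hJx.iIndepFun_of_covariance_eq_zero fun l m hlm => by
      simpa [hlm] using hV.covariance_mulVec x l m
  refine iIndepFun.hasLaw_pi (X := fun l ω => (V ω).mulVec x l) (fun l => ?_) hind
  have hl := hJx.eval l
  refine ⟨hl.aemeasurable, ?_⟩
  have hvar : Var[fun ω => (V ω).mulVec x l; μ] = 1 := by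
    rw [← covariance_self hl.aemeasurable, hV.covariance_mulVec, if_pos rfl, hx]
  have hmean : ∫ ω, (V ω).mulVec x l ∂μ = 0 := by
    simp only [Matrix.mulVec, dotProduct]
    rw [integral_finsetSum _ fun j _ =>
      (hV.hasLaw_entry l j).hasGaussianLaw.integrable.mul_const _]
    refine Finset.sum_eq_zero fun j _ => ?_
    rw [integral_mul_const, (hV.hasLaw_entry l j).integral_eq, integral_id_gaussianReal, zero_mul]
  rw [hl.map_eq_gaussianReal, hmean, hvar, Real.toNNReal_one]

end IsStdGaussianMatrix

end SparsestElement

/-! ### Nets of the unit sphere. -/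

namespace SparsestElement

open Module Metric
open scoped ENNReal NNReal Function

/-- Volume bound: an `ε`-separated subset of the unit ball has at most `(1 + 2 / ε) ^ dim` points. -/
lemma card_le_of_separated {E : Type*} [NormedAddCommGroup E] [NormedSpace ℝ E]
    [FiniteDimensional ℝ E] {ε : ℝ} (hε : 0 < ε) (s : Finset E) (hs : ∀ c ∈ s, ‖c‖ ≤ 1)
    (h : ∀ c ∈ s, ∀ d ∈ s, c ≠ d → ε ≤ ‖c - d‖) : (s.card : ℝ) ≤ (1 + 2 / ε) ^ finrank ℝ E := by
  borelize E
  let μ : Measure E := Measure.addHaar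
  have hD : Set.Pairwise (s : Set E) (Disjoint on fun c => ball c (ε / 2)) := by
    intro c hc d hd hcd
    apply ball_disjoint_ball
    rw [dist_eq_norm, add_halves]
    exact h c hc d hd hcd
  have hsub : ⋃ c ∈ s, ball c (ε / 2) ⊆ ball (0 : E) (1 + ε / 2) := by
    refine Set.iUnion₂_subset fun x hx => ball_subset_ball' ?_
    rw [dist_zero_right, add_comm]
    gcongr
    exact hs x hx
  have hI : (s.card : ℝ≥0∞) * ENNReal.ofReal ((ε / 2) ^ finrank ℝ E) * μ (ball 0 1) ≤
      ENNReal.ofReal ((1 + ε / 2) ^ finrank ℝ E) * μ (ball 0 1) :=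
    calc _ = μ (⋃ c ∈ s, ball c (ε / 2)) := by
          rw [measure_biUnion_finset hD fun c _ => measurableSet_ball]
          simp only [μ.addHaar_ball_of_pos _ (half_pos hε), Finset.sum_const, nsmul_eq_mul,
            mul_assoc]
      _ ≤ μ (ball (0 : E) (1 + ε / 2)) := measure_mono hsub
      _ = _ := μ.addHaar_ball_of_pos _ (by positivity)
  have hJ := (ENNReal.mul_le_mul_iff_left (measure_ball_pos _ _ zero_lt_one).ne'
    measure_ball_lt_top.ne).1 hI
  have hK := ENNReal.toReal_le_of_le_ofReal (by positivity) hJ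
  rw [ENNReal.toReal_mul, ENNReal.toReal_natCast, ENNReal.toReal_ofReal (by positivity),
    ← le_div_iff₀ (by positivity), ← div_pow] at hK
  refine hK.trans_eq ?_
  congr 1
  field_simp
  ring

lemma exists_finset_cover_sphere (E : Type*) [NormedAddCommGroup E] [NormedSpace ℝ E]
    [FiniteDimensional ℝ E] {ε : ℝ} (hε : 0 < ε) :
    ∃ N : Finset E, (∀ x ∈ N, ‖x‖ = 1) ∧ (N.card : ℝ) ≤ (1 + 2 / ε) ^ finrank ℝ E ∧
      ∀ x : E, ‖x‖ = 1 → ∃ y ∈ N, ‖x - y‖ ≤ ε := by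
  classical
  -- The volume bound caps the size of separated sets, so one of largest size exists; a sphere point
  -- farther than `ε` from it could be added.
  let P : ℕ → Prop := fun m => ∃ s : Finset E, s.card = m ∧ (∀ x ∈ s, ‖x‖ = 1) ∧
    ∀ c ∈ s, ∀ d ∈ s, c ≠ d → ε ≤ ‖c - d‖
  have hb (m : ℕ) (hm : P m) : m ≤ ⌊(1 + 2 / ε) ^ finrank ℝ E⌋₊ := by
    obtain ⟨s, rfl, h1, h2⟩ := hm
    exact Nat.le_floor (card_le_of_separated hε s (fun c hc => (h1 c hc).le) h2)
  have hP : P (Nat.findGreatest P ⌊(1 + 2 / ε) ^ finrank ℝ E⌋₊) :=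
    Nat.findGreatest_spec (P := P) (Nat.zero_le _) ⟨∅, by simp⟩
  obtain ⟨N, hN, h1, h2⟩ := hP
  refine ⟨N, h1, card_le_of_separated hε N (fun c hc => (h1 c hc).le) h2, fun x hx => ?_⟩
  by_contra! hfar
  have hxN : x ∉ N := fun hmem => by
    have := hfar x hmem
    rw [sub_self, norm_zero] at this
    linarith
  have hP' : P (N.card + 1) := by
    refine ⟨insert x N, Finset.card_insert_of_notMem hxN, ?_, ?_⟩
    · intro y hy
      rcases Finset.mem_insert.1 hy with rfl | hy
      exacts [hx, h1 y hy]
    · intro c hc d hd hcd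
      rcases Finset.mem_insert.1 hc with rfl | hcN <;>
        rcases Finset.mem_insert.1 hd with rfl | hdN
      · exact absurd rfl hcd
      · exact (hfar d hdN).le
      · rw [norm_sub_rev]; exact (hfar c hcN).le
      · exact h2 c hcN d hdN hcd
  have := Nat.le_findGreatest (hb _ hP') hP'
  omega

/-- Bounds on `‖T y‖` for `y` in an `ε`-net of the unit sphere extend to all vectors. -/
lemma norm_bounds_of_bounds_on_net {E F : Type*} [NormedAddCommGroup E] [NormedSpace ℝ E]
    [NormedAddCommGroup F] [NormedSpace ℝ F] (T : E →L[ℝ] F) {ε a b : ℝ} (hε : ε ≤ 1 / 2)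
    (hb : 0 ≤ b) {N : Set E} (hN : ∀ x : E, ‖x‖ = 1 → ∃ y ∈ N, ‖x - y‖ ≤ ε)
    (hT : ∀ y ∈ N, a ≤ ‖T y‖ ∧ ‖T y‖ ≤ b) (x : E) :
    (a - 2 * b * ε) * ‖x‖ ≤ ‖T x‖ ∧ ‖T x‖ ≤ 2 * b * ‖x‖ := by
  have hop : ‖T‖ ≤ 2 * b := by
    rcases le_or_gt ‖T‖ 0 with h0 | h0
    · linarith
    -- Self-bounding: the error of approximation by the net costs at most half of `‖T‖`, which is
    -- absorbed on the left.
    have : ‖T‖ ≤ b + ‖T‖ * (1 / 2) :=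
      T.opNorm_le_of_unit_norm (by positivity) fun x hx => by
        obtain ⟨y, hy, hxy⟩ := hN x hx
        calc ‖T x‖ = ‖T y + T (x - y)‖ := by rw [map_sub, add_sub_cancel]
          _ ≤ ‖T y‖ + ‖T (x - y)‖ := norm_add_le _ _
          _ ≤ b + ‖T‖ * (1 / 2) := by
            gcongr
            · exact (hT y hy).2
            · exact T.le_of_opNorm_le_of_le le_rfl (hxy.trans hε)
    linarith
  refine ⟨?_, T.le_of_opNorm_le hop x⟩
  rcases eq_or_ne x 0 with rfl | hx
  · simp
  obtain ⟨y, hy, hxy⟩ := hN (‖x‖⁻¹ • x) (norm_smul_inv_norm (𝕜 := ℝ) hx)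
  have h1 : ‖T y‖ ≤ ‖T (‖x‖⁻¹ • x)‖ + ‖T (‖x‖⁻¹ • x - y)‖ := by
    have := norm_sub_le (T (‖x‖⁻¹ • x)) (T (‖x‖⁻¹ • x - y))
    rwa [← map_sub, sub_sub_cancel] at this
  have h2 : ‖T (‖x‖⁻¹ • x - y)‖ ≤ 2 * b * ε := T.le_of_opNorm_le_of_le hop hxy
  have h3 : ‖T x‖ = ‖T (‖x‖⁻¹ • x)‖ * ‖x‖ := by
    rw [map_smul, norm_smul, norm_inv, norm_norm, mul_right_comm,
      inv_mul_cancel₀ (norm_ne_zero_iff.2 hx), one_mul]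
  rw [h3]
  gcongr
  linarith [(hT y hy).1]

end SparsestElement

/-! ### Deterministic consequences of the norm bounds. -/

namespace SparsestElement

/-- Matrix-vector multiplication from `ℓ₂` to `ℓ₁`. -/
noncomputable def mulVecL1 {n k : ℕ} (A : Matrix (Fin n) (Fin k) ℝ) :
    EuclideanSpace ℝ (Fin k) →L[ℝ] PiLp 1 fun _ : Fin n => ℝ :=
  LinearMap.toContinuousLinearMap
    ((WithLp.linearEquiv 1 ℝ (Fin n → ℝ)).symm.toLinearMap ∘ₗ A.mulVecLin ∘ₗ
      (WithLp.linearEquiv 2 ℝ (Fin k → ℝ)).toLinearMap)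

lemma norm_mulVecL1 {n k : ℕ} (A : Matrix (Fin n) (Fin k) ℝ) (x : EuclideanSpace ℝ (Fin k)) :
    ‖mulVecL1 A x‖ = l1Norm (A.mulVec x.ofLp) := by
  simp [mulVecL1, PiLp.norm_eq_of_L1, l1Norm]

/-- Since `|v i| = ‖v‖`, the ratio of `v` is exactly the objective value of the normalized vector.
-/
lemma l1LinfRatio_le_of_solvesProgram {n : ℕ} {W : Submodule ℝ (Fin n → ℝ)} {i : Fin n}
    {v y : Fin n → ℝ} (hvi : ∀ l, |v l| ≤ |v i|) (h : SolvesProgram W i ((v i)⁻¹ • v))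
    (hy : y ∈ W) (hyi : y i = 1) : l1LinfRatio v ≤ l1Norm y := by
  have hnorm : ‖v‖ = |v i| :=
    le_antisymm ((pi_norm_le_iff_of_nonneg (abs_nonneg _)).2 hvi) (norm_le_pi_norm v i)
  refine le_of_eq_of_le ?_ (h.2 y hy hyi)
  simp [l1LinfRatio, l1Norm, hnorm, abs_mul, ← Finset.mul_sum, div_eq_inv_mul]

/-- A vector with an entry `1` has sup norm at least `1`, so its ratio is at most its `ℓ₁` norm. -/
lemma l1LinfRatio_le_of_minimizesRatio {n : ℕ} {W : Submodule ℝ (Fin n → ℝ)} {i : Fin n}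
    {v y : Fin n → ℝ} (h : MinimizesRatio W v) (hy : y ∈ W) (hyi : y i = 1) :
    l1LinfRatio v ≤ l1Norm y := by
  have hy0 : y ≠ 0 := fun h0 => by simp [h0] at hyi
  have h1 : 1 ≤ ‖y‖ := by simpa [hyi] using norm_le_pi_norm y i
  exact (h.2 y hy hy0).trans (div_le_self (Finset.sum_nonneg fun _ _ => abs_nonneg _) h1)

lemma mulVec_mem_plantedSubspace {n k : ℕ} (v : Fin n → ℝ) (A : Matrix (Fin n) (Fin k) ℝ)
    (x : Fin k → ℝ) : A.mulVec x ∈ plantedSubspace v A := by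
  have : A.mulVec x = ∑ j, x j • fun l => A l j := by
    ext l
    simp [Matrix.mulVec, dotProduct, mul_comm]
  rw [this]
  exact Submodule.sum_mem _ fun j _ =>
    Submodule.smul_mem _ _ (Submodule.subset_span (Or.inr ⟨j, rfl⟩))

/-- The program attains its minimum if `x ↦ ‖A x‖₁` is coercive and the program is feasible. -/
lemma exists_isProgramMin {n k : ℕ} {A : Matrix (Fin n) (Fin k) ℝ} {i : Fin n} {a : ℝ} (ha : 0 < a)
    (hA : ∀ x, a * ‖x‖ ≤ ‖mulVecL1 A x‖) {x₀ : Fin k → ℝ} (hx₀ : A.mulVec x₀ i = 1) :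
    ∃ m, IsProgramMin A i m := by
  have hcont : Continuous fun x : EuclideanSpace ℝ (Fin k) => ‖mulVecL1 A x‖ := by fun_prop
  have hcl : IsClosed {x : EuclideanSpace ℝ (Fin k) | A.mulVec x.ofLp i = 1} := by
    refine isClosed_eq ?_ continuous_const
    simp only [Matrix.mulVec, dotProduct]
    fun_prop
  obtain ⟨x, hx, hmin⟩ := hcont.continuousOn.exists_isMinOn' hcl (x₀ := WithLp.toLp 2 x₀) hx₀
    (by
      refine Filter.Eventually.filter_mono inf_le_left ?_
      have hco : Filter.Tendsto (fun x : EuclideanSpace ℝ (Fin k) => ‖mulVecL1 A x‖)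
          (Filter.cocompact _) Filter.atTop :=
        Filter.tendsto_atTop_mono hA (tendsto_norm_cocompact_atTop.const_mul_atTop ha)
      exact hco.eventually_ge_atTop _)
  refine ⟨_, ⟨x.ofLp, hx, rfl⟩, ?_⟩
  rintro t ⟨y, hy, rfl⟩
  have := hmin (show WithLp.toLp 2 y ∈ {x : EuclideanSpace ℝ (Fin k) | A.mulVec x.ofLp i = 1} from hy)
  simpa only [Set.mem_ofPred_eq, norm_mulVecL1] using this

/-- The conclusions of the theorem hold for every matrix that distorts `ℓ₂` into `ℓ₁` by a bounded
factor and whose `i`-th row has norm of order `√k`. -/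
lemma conclusions_of_bounds {n k : ℕ} (hk : 1 ≤ k) {A : Matrix (Fin n) (Fin k) ℝ} {i : Fin n}
    {a b r R : ℝ} (ha : 0 < a) (hb : 0 < b) (hr : 0 < r) (hR : 0 < R)
    (hA : ∀ x, a * n * ‖x‖ ≤ ‖mulVecL1 A x‖ ∧ ‖mulVecL1 A x‖ ≤ b * n * ‖x‖)
    (hrow : r * √k ≤ ‖WithLp.toLp 2 (A i)‖ ∧ ‖WithLp.toLp 2 (A i)‖ ≤ R * √k) :
    (∃ m : ℝ, IsProgramMin A i m ∧ a / R * ((n : ℝ) / √k) ≤ m ∧ m ≤ b / r * ((n : ℝ) / √k)) ∧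
    (∀ v : Fin n → ℝ, v ≠ 0 → (∀ l, |v l| ≤ |v i|) →
      SolvesProgram (plantedSubspace v A) i ((v i)⁻¹ • v) →
      l1LinfRatio v ≤ b / r * ((n : ℝ) / √k)) ∧
    (∀ v : Fin n → ℝ, MinimizesRatio (plantedSubspace v A) v →
      l1LinfRatio v ≤ b / r * ((n : ℝ) / √k)) := by
  have hk' : 0 < √(k : ℝ) := Real.sqrt_pos.2 (by exact_mod_cast hk)
  have hn' : (0 : ℝ) < n := by exact_mod_cast i.pos
  set u : EuclideanSpace ℝ (Fin k) := WithLp.toLp 2 (A i) with hu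
  have hu0 : 0 < ‖u‖ := lt_of_lt_of_le (by positivity) hrow.1
  have hinner (x : EuclideanSpace ℝ (Fin k)) : A.mulVec x.ofLp i = inner ℝ u x := by
    simp [hu, Matrix.mulVec, dotProduct, PiLp.inner_apply, mul_comm]
  -- The point of least Euclidean norm on the hyperplane `⟨u, x⟩ = 1`.
  set x₀ : EuclideanSpace ℝ (Fin k) := (‖u‖ ^ 2)⁻¹ • u with hx₀
  have hfeas : A.mulVec x₀.ofLp i = 1 := by
    rw [hinner, hx₀, inner_smul_right, real_inner_self_eq_norm_sq, inv_mul_cancel₀ (by positivity)]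
  have hval : l1Norm (A.mulVec x₀.ofLp) ≤ b / r * (n / √k) := by
    rw [← norm_mulVecL1]
    calc _ ≤ b * n * ‖x₀‖ := (hA x₀).2
      _ = b * n / ‖u‖ := by
        rw [hx₀, norm_smul, norm_inv, norm_pow, norm_norm]; field_simp
      _ ≤ b * n / (r * √k) := by gcongr; exact hrow.1
      _ = _ := by field_simp
  refine ⟨?_, fun v _ hvi h => ?_, fun v h => ?_⟩
  · obtain ⟨m, hm⟩ := exists_isProgramMin (mul_pos ha hn') (fun x => (hA x).1) hfeas
    refine ⟨m, hm, ?_, (hm.2 ⟨_, hfeas, rfl⟩).trans hval⟩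
    obtain ⟨x, hx, rfl⟩ := hm.1
    have h1 : 1 ≤ R * √k * ‖WithLp.toLp 2 x‖ := by
      have := real_inner_le_norm u (WithLp.toLp 2 x)
      rw [← hinner, hx] at this
      exact this.trans (by gcongr; exact hrow.2)
    have h2 := (hA (WithLp.toLp 2 x)).1
    rw [norm_mulVecL1] at h2
    calc a / R * (n / √k) = a * n / (R * √k) * 1 := by field_simp
      _ ≤ a * n / (R * √k) * (R * √k * ‖WithLp.toLp 2 x‖) := by gcongr
      _ = a * n * ‖WithLp.toLp 2 x‖ := by field_simp
      _ ≤ _ := h2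
  · exact (l1LinfRatio_le_of_solvesProgram hvi h
      (mulVec_mem_plantedSubspace v A x₀.ofLp) hfeas).trans hval
  · exact (l1LinfRatio_le_of_minimizesRatio h
      (mulVec_mem_plantedSubspace v A x₀.ofLp) hfeas).trans hval

end SparsestElement

/-! ### Numerical constants and the union bound. -/

namespace SparsestElement

lemma sum_abs_le_of_sum_sq_le {ι : Type*} [Fintype ι] {y : ι → ℝ}
    (h : ∑ l, y l ^ 2 ≤ 16 * Fintype.card ι) : ∑ l, |y l| ≤ 4 * Fintype.card ι := by
  apply le_of_sq_le_sq _ (by positivity)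
  calc (∑ l, |y l|) ^ 2 ≤ Fintype.card ι * ∑ l, |y l| ^ 2 := sq_sum_le_card_mul_sum_sq
    _ ≤ Fintype.card ι * (16 * Fintype.card ι) := by
      gcongr; simpa only [sq_abs] using h
    _ = _ := by ring

lemma exists_net_card_le_exp (k : ℕ) :
    ∃ N : Finset (EuclideanSpace ℝ (Fin k)), (∀ x ∈ N, ‖x‖ = 1) ∧
      (N.card : ℝ) ≤ Real.exp (16 * k) ∧
      ∀ x : EuclideanSpace ℝ (Fin k), ‖x‖ = 1 → ∃ y ∈ N, ‖x - y‖ ≤ 1 / 3200 := by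
  obtain ⟨N, h1, h2, h3⟩ := exists_finset_cover_sphere (EuclideanSpace ℝ (Fin k))
    (ε := 1 / 3200) (by norm_num)
  refine ⟨N, h1, h2.trans ?_, h3⟩
  rw [finrank_euclideanSpace_fin, mul_comm, Real.exp_nat_mul]
  have h : (2 : ℝ) ≤ Real.exp 1 := by linarith [Real.add_one_le_exp 1]
  gcongr
  calc (1 + 2 / (1 / 3200) : ℝ) ≤ 2 ^ 16 := by norm_num
    _ ≤ Real.exp 1 ^ 16 := by gcongr
    _ = Real.exp 16 := by rw [← Real.exp_nat_mul]; norm_num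

/-- The lower bound is Cauchy–Schwarz applied to the `ℓ₁` bound, so no separate lower tail for the
sum of squares is needed. -/
lemma row_norm_bounds {k : ℕ} {y : Fin k → ℝ} (h1 : (k : ℝ) / 200 < ∑ j, |y j|)
    (h2 : ∑ j, y j ^ 2 < 16 * k) :
    1 / 200 * √k ≤ ‖WithLp.toLp 2 y‖ ∧ ‖WithLp.toLp 2 y‖ ≤ 4 * √k := by
  rw [EuclideanSpace.norm_eq]
  simp only [Real.norm_eq_abs, sq_abs]
  constructor
  · apply Real.le_sqrt_of_sq_le
    rcases k.eq_zero_or_pos with rfl | hk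
    · simp
    have hk' : (0 : ℝ) < k := by exact_mod_cast hk
    have hcs : (∑ j, |y j|) ^ 2 ≤ k * ∑ j, y j ^ 2 := by
      simpa using sq_sum_le_card_mul_sum_sq (s := Finset.univ) (f := fun j => |y j|)
    have h3 : ((k : ℝ) / 200) ^ 2 ≤ k * ∑ j, y j ^ 2 := (by gcongr : _ ≤ (∑ j, |y j|) ^ 2).trans hcs
    rw [mul_pow, Real.sq_sqrt hk'.le]
    refine le_of_mul_le_mul_left (le_of_eq_of_le ?_ h3) hk'
    ring
  · rw [Real.sqrt_le_left (by positivity), mul_pow, Real.sq_sqrt (Nat.cast_nonneg k)]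
    linarith

end SparsestElement

open SparsestElement in
theorem mainTheorem3 :
    ∃ c C γ₁ γ₂ γ₃ γ₄ : ℝ, 0 < c ∧ 0 < C ∧ 0 < γ₁ ∧ 0 < γ₂ ∧ 0 < γ₃ ∧ 0 < γ₄ ∧
      ∀ (n k : ℕ), 1 ≤ k → (k : ℝ) ≤ (n : ℝ) / 16 → ∀ (i : Fin n)
        (Ω : Type*) [MeasurableSpace Ω] (μ : Measure Ω) [IsProbabilityMeasure μ]
        (V : Ω → Matrix (Fin n) (Fin k) ℝ), SparsestElement.IsStdGaussianMatrix V μ →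
        μ {ω | ¬ (
            -- the minimum is attained and comparable to `n / √k`
            (∃ m : ℝ, SparsestElement.IsProgramMin (V ω) i m ∧
              c * ((n : ℝ) / Real.sqrt k) ≤ m ∧ m ≤ C * ((n : ℝ) / Real.sqrt k)) ∧
            -- the program normalized at a largest entry of a planted `v` can only recover `v`
            -- below this scaling
            (∀ v : Fin n → ℝ, v ≠ 0 → (∀ l, |v l| ≤ |v i|) →
              SparsestElement.SolvesProgram (SparsestElement.plantedSubspace v (V ω)) i
                ((v i)⁻¹ • v) →
              SparsestElement.l1LinfRatio v ≤ C * ((n : ℝ) / Real.sqrt k)) ∧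
            -- the same for minimization of the ratio `‖z‖₁ / ‖z‖_∞`
            (∀ v : Fin n → ℝ,
              SparsestElement.MinimizesRatio (SparsestElement.plantedSubspace v (V ω)) v →
              SparsestElement.l1LinfRatio v ≤ C * ((n : ℝ) / Real.sqrt k)))}
          ≤ ENNReal.ofReal
              (γ₁ * Real.exp (-(γ₂ * (n : ℝ))) + γ₃ * Real.exp (-(γ₄ * (k : ℝ)))) := by
  -- These are `a / R` and `b / r` of `conclusions_of_bounds` with `a = 1/400`, `b = 8`, `r =
  -- 1/200`, `R = 4`. Each factor `2` counts a pair of bad events.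
  refine ⟨1 / 400 / 4, 8 / (1 / 200), 2, 2, 2, 3, by norm_num, by norm_num, by norm_num,
    by norm_num, by norm_num, by norm_num, ?_⟩
  intro n k hk hkn i Ω _ μ _ V hV
  obtain ⟨N, hN1, hNcard, hN⟩ := exists_net_card_le_exp k
  have hlaw (y) (hy : y ∈ N) :
      HasLaw (fun ω => (V ω).mulVec y.ofLp) (Measure.pi fun _ => gaussianReal 0 1) μ :=
    hV.hasLaw_mulVec (by simpa [hN1 y hy] using (EuclideanSpace.real_norm_sq_eq y).symm)
  have hrow := hV.hasLaw_row i
  set B₁ : Set Ω := ⋃ y ∈ N, {ω | ∑ l, |(V ω).mulVec y.ofLp l| ≤ n / 200} with hB₁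
  set B₂ : Set Ω := ⋃ y ∈ N, {ω | 16 * (n : ℝ) ≤ ∑ l, (V ω).mulVec y.ofLp l ^ 2} with hB₂
  set B₃ : Set Ω := {ω | ∑ j, |V ω i j| ≤ k / 200} with hB₃
  set B₄ : Set Ω := {ω | 16 * (k : ℝ) ≤ ∑ j, V ω i j ^ 2} with hB₄
  -- The hypothesis `k ≤ n / 16` enters here.
  have hNn : (N.card : ℝ) ≤ Real.exp n := hNcard.trans (Real.exp_le_exp.2 (by linarith))
  have hn0 : (0 : ℝ) ≤ n := Nat.cast_nonneg n
  have hk0 : (0 : ℝ) ≤ k := Nat.cast_nonneg k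
  have hunion (S : EuclideanSpace ℝ (Fin k) → Set Ω)
      (hS : ∀ y ∈ N, μ (S y) ≤ ENNReal.ofReal (Real.exp (-3 * n))) :
      μ (⋃ y ∈ N, S y) ≤ ENNReal.ofReal (Real.exp (-(2 * n))) := by
    calc _ ≤ ∑ y ∈ N, μ (S y) := measure_biUnion_finset_le N S
      _ ≤ N.card • ENNReal.ofReal (Real.exp (-3 * n)) := Finset.sum_le_card_nsmul _ _ _ hS
      _ = ENNReal.ofReal (N.card * Real.exp (-3 * n)) := by
        rw [nsmul_eq_mul, ENNReal.ofReal_mul (Nat.cast_nonneg _), ENNReal.ofReal_natCast]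
      _ ≤ ENNReal.ofReal (Real.exp n * Real.exp (-3 * n)) := by gcongr
      _ = _ := by rw [← Real.exp_add]; congr 2; ring
  have h₁ : μ B₁ ≤ ENNReal.ofReal (Real.exp (-(2 * n))) := hunion _ fun y hy => by
    refine le_trans (by simpa using measure_sum_abs_le (hlaw y hy)) (ENNReal.ofReal_le_ofReal
      (Real.exp_le_exp.2 (by linarith : -(4 * (n : ℝ)) ≤ -3 * n)))
  have h₂ : μ B₂ ≤ ENNReal.ofReal (Real.exp (-(2 * n))) := hunion _ fun y hy => by
    simpa using measure_le_sum_sq (hlaw y hy)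
  have h₃ : μ B₃ ≤ ENNReal.ofReal (Real.exp (-(3 * k))) :=
    le_trans (by simpa using measure_sum_abs_le hrow) (ENNReal.ofReal_le_ofReal
      (Real.exp_le_exp.2 (by linarith : -(4 * (k : ℝ)) ≤ -(3 * k))))
  have h₄ : μ B₄ ≤ ENNReal.ofReal (Real.exp (-(3 * k))) := by
    simpa using measure_le_sum_sq hrow
  calc _ ≤ μ ((B₁ ∪ B₂) ∪ (B₃ ∪ B₄)) := by
        refine measure_mono fun ω hω => ?_
        by_contra hgood
        refine hω ?_
        simp only [Set.mem_union, not_or, hB₁, hB₂, hB₃, hB₄, Set.mem_iUnion, Set.mem_ofPred_eq,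
          not_exists, not_le] at hgood
        obtain ⟨⟨hg₁, hg₂⟩, hg₃, hg₄⟩ := hgood
        refine conclusions_of_bounds hk (by norm_num) (by norm_num) (by norm_num) (by norm_num)
          (fun x => ?_) (row_norm_bounds hg₃ hg₄)
        -- The mesh `1/3200` makes the loss `2 * (4 n) * ε = n / 400`, half of `n / 200`.
        have h := norm_bounds_of_bounds_on_net (mulVecL1 (V ω)) (ε := 1 / 3200) (a := n / 200)
          (b := 4 * n) (N := N) (by norm_num) (by positivity) hN (fun y hy => ?_) x
        · convert h using 2 <;> ring
        · rw [norm_mulVecL1]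
          refine ⟨(hg₁ y hy).le, ?_⟩
          simpa [l1Norm] using sum_abs_le_of_sum_sq_le (y := (V ω).mulVec y.ofLp)
            (by simpa using (hg₂ y hy).le)
    _ ≤ (μ B₁ + μ B₂) + (μ B₃ + μ B₄) :=
        (measure_union_le _ _).trans (add_le_add (measure_union_le _ _) (measure_union_le _ _))
    _ ≤ (ENNReal.ofReal (Real.exp (-(2 * n))) + ENNReal.ofReal (Real.exp (-(2 * n)))) +
        (ENNReal.ofReal (Real.exp (-(3 * k))) + ENNReal.ofReal (Real.exp (-(3 * k)))) := by gcongr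
    _ = _ := by
        rw [← ENNReal.ofReal_add, ← ENNReal.ofReal_add, ← ENNReal.ofReal_add] <;>
          first | positivity | (congr 1; ring)
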